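/- Consider a $(G,K,M\times N)$ cluster: $G$ cells, each with one base station (BS) having $N$ antennas and $K$ users having $M$ antennas each, every user being served one data stream. For $1\le i,g\le G$ and $1\le k\le K$ let $\mathbf H_{(i,gk)}\in\mathbb C^{M\times N}$ be the channel from BS $i$ to the $k$th user of cell $g$. Let $\mathcal I\subseteq\{(i,gk): i\ne g\}$ be a set of BS-user pairs. Partial interference alignment (IA) for $\mathcal I$ is called feasible if there are nonzero receive beamformers $\mathbf u_{gk}\in\mathbb C^M$ and transmit beamformers $\mathbf v_{gk}\in\mathbb C^N$ such that $\mathbf v_{g1},\dots,\mathbf v_{gK}$ are linearly independent for every $g$ and $$\mathbf u_{gk}^H\,\mathbf H_{(i,gk)}\,\mathbf v_{ij}=0\qquad\text{for all }(i,gk)\in\mathcal I\text{ and all }j\in\{1,\dots,K\}.$$ A property holds for generic channels if it holds for all channels $(\mathbf H_{(i,gk)})_{i,g,k}$ in some nonempty Zariski open subset of the complex affine space of all channel coefficients. Let $1\le q\le G-1$ and suppose that for every user $gk$ there are at most $q$ BSs $i$ with $(i,gk)\in\mathcal I$, and for every BS $i$ there are at most $Kq$ users $gk$ with $(i,gk)\in\mathcal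 I$. If $$M\ge 1,\qquad N\ge K,\qquad M+N\ge K(q+1)+1,$$ then partial IA for $\mathcal I$ is feasible for generic channels. In particular (the case $q=G-1$), if $G\ge 2$, $M\ge1$, $N\ge K$ and $M+N\ge GK+1$, then complete IA, that is, partial IA for the set of all $(G-1)GK$ pairs $(i,gk)$ with $i\neq g$, is feasible for generic channels. -/

import Mathlib

open Matrix

/-- Indices of the scalar channel coefficients of a `(G, K, M × N)` cluster: `(i, (g, k), m, n)`
is the entry `(m, n)` of the `M × N` channel from BS `i` to the `k`-th user of cell `g`. -/
abbrev ChannelIndex (G K M N : ℕ) : Type :=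
  Fin G × (Fin G × Fin K) × Fin M × Fin N

/-- The `M × N` channel matrix from BS `i` to the user `a = (g, k)`. -/
def channelMatrix {G K M N : ℕ} (h : ChannelIndex G K M N → ℂ) (i : Fin G) (a : Fin G × Fin K) :
    Matrix (Fin M) (Fin N) ℂ :=
  Matrix.of fun m n => h (i, a, m, n)

/-- The receive beamformers `u` and transmit beamformers `v` solve the partial interference
alignment problem for the set `I` of BS-user pairs: receive beamformers are nonzero, the transmit
beamformers of each BS are linearly independent, and for every pair `(i, a) ∈ I` each of the `K`
signals of BS `i` is nulled at the user `a`. -/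
structure IsAligned {G K M N : ℕ} (h : ChannelIndex G K M N → ℂ)
    (I : Finset (Fin G × (Fin G × Fin K)))
    (u : Fin G × Fin K → Fin M → ℂ) (v : Fin G × Fin K → Fin N → ℂ) : Prop where
  receive_ne_zero : ∀ a, u a ≠ 0
  transmit_linearIndependent : ∀ g : Fin G, LinearIndependent ℂ fun k : Fin K => v (g, k)
  nulled : ∀ i a, (i, a) ∈ I → ∀ j : Fin K,
    star (u a) ⬝ᵥ (channelMatrix h i a *ᵥ v (i, j)) = 0

/-- Partial interference alignment for `I` is feasible for the channel coefficients `h`. -/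
def PartialIAFeasible {G K M N : ℕ} (h : ChannelIndex G K M N → ℂ)
    (I : Finset (Fin G × (Fin G × Fin K))) : Prop :=
  ∃ (u : Fin G × Fin K → Fin M → ℂ) (v : Fin G × Fin K → Fin N → ℂ), IsAligned h I u v

/-- A subset of affine space is Zariski open if it is the complement of the common zero set of
some set of polynomials. -/
def IsZariskiOpen {σ : Type*} (U : Set (σ → ℂ)) : Prop :=
  ∃ S : Set (MvPolynomial σ ℂ), U = {x | ∀ p ∈ S, MvPolynomial.eval x p = 0}ᶜ

/-- A property of points of affine space is generic if it holds on a nonempty Zariski open set. -/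
def HoldsGenerically {σ : Type*} (P : (σ → ℂ) → Prop) : Prop :=
  ∃ U : Set (σ → ℂ), U.Nonempty ∧ IsZariskiOpen U ∧ ∀ x ∈ U, P x

/-- The set of all `(G - 1) G K` BS-user pairs in which the BS is not in the cell of the user. -/
def allPairs (G K : ℕ) : Finset (Fin G × (Fin G × Fin K)) :=
  Finset.univ.filter fun p => p.2.1 ≠ p.1

/-! Normalise the beamformers to `u = (1, x)` and `v = (e_j, y)`. For each `(i, a) ∈ I` the
alignment equations then express the first `K` entries of the first row of the channel in terms of
its other entries, `x` and `y`, so the channels with an aligned solution contain the image of an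
explicit polynomial map. By Chevalley's theorem and the Nullstellensatz this image contains a
nonempty Zariski open set as soon as the coordinates of the map are algebraically independent, for
which it suffices that its differential is onto at one point. At `x = y = 0` surjectivity is the
solvability of one linear equation `α ⬝ᵥ y + x ⬝ᵥ β = w` for every user and every stream
interfering with it. By Hall's theorem each equation can be charged to its user or to its stream
so that no user is charged more than `M - 1` times and no stream more than `N - K` times; with
Vandermonde coefficients the equations charged to one vector of unknowns are solved by
interpolation. -/

section DominantPolynomialMaps

open MvPolynomial

theorem exists_ne_zero_basicOpen_subset_of_isConstructible {R : Type*} [CommRing R] [IsDomain R]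
    {Z : Set (PrimeSpectrum R)} (hZ : Topology.IsConstructible Z) (hbot : ⊥ ∈ Z) :
    ∃ f : R, f ≠ 0 ∧ (PrimeSpectrum.basicOpen f : Set (PrimeSpectrum R)) ⊆ Z := by
  obtain ⟨S, rfl⟩ := PrimeSpectrum.exists_constructibleSetData_iff.mpr hZ
  obtain ⟨B, hBS, hgB, hfB⟩ := Set.mem_iUnion₂.mp hbot
  have hg : ∀ i, B.g i = 0 := fun i => by simpa using hgB (Set.mem_range_self i)
  refine ⟨B.f, fun hf => hfB (by simp [hf]), fun 𝔭 h𝔭 => Set.mem_iUnion₂.mpr ⟨B, hBS, ?_, ?_⟩⟩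
  · rintro _ ⟨i, rfl⟩
    simp [hg]
  · simpa using h𝔭

theorem exists_forall_mem_eval_eq_zero {k τ : Type*} [Field k] [IsAlgClosed k] [Finite τ]
    {J : Ideal (MvPolynomial τ k)} (hJ : J ≠ ⊤) : ∃ t : τ → k, ∀ p ∈ J, eval t p = 0 := by
  obtain ⟨𝔪, h𝔪, hJ𝔪⟩ := Ideal.exists_le_maximal J hJ
  obtain ⟨t, rfl⟩ := isMaximal_iff_eq_vanishingIdeal_singleton.mp h𝔪
  exact ⟨t, fun p hp => (mem_vanishingIdeal_singleton_iff t p).mp (hJ𝔪 hp)⟩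

theorem finitePresentation_aeval {k σ τ : Type*} [Field k] [Finite σ] [Finite τ]
    (F : σ → MvPolynomial τ k) : (aeval F : _ →ₐ[k] _).toRingHom.FinitePresentation := by
  refine RingHom.FinitePresentation.of_finiteType.mp
    (RingHom.FiniteType.of_comp_finiteType (f := algebraMap k (MvPolynomial σ k)) ?_)
  rw [AlgHom.toRingHom_eq_coe, AlgHom.comp_algebraMap, RingHom.finiteType_algebraMap]
  infer_instance

theorem exists_ne_zero_setOf_eval_ne_zero_subset_range {k σ τ : Type*} [Field k] [IsAlgClosed k]
    [Finite σ] [Finite τ] {F : σ → MvPolynomial τ k} (hF : AlgebraicIndependent k F) :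
    ∃ q : MvPolynomial σ k, q ≠ 0 ∧
      {x | eval x q ≠ 0} ⊆ Set.range fun (t : τ → k) s => eval t (F s) := by
  let φ : MvPolynomial σ k →+* MvPolynomial τ k := (aeval F : _ →ₐ[k] _).toRingHom
  have hbot : ⊥ ∈ Set.range (PrimeSpectrum.comap φ) :=
    ⟨⊥, PrimeSpectrum.ext ((RingHom.injective_iff_ker_eq_bot φ).mp hF)⟩
  obtain ⟨q, hq, hsub⟩ := exists_ne_zero_basicOpen_subset_of_isConstructible
    (PrimeSpectrum.isConstructible_range_comap (finitePresentation_aeval F)) hbot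
  refine ⟨q, hq, fun x hx => ?_⟩
  obtain ⟨𝔮, h𝔮⟩ := @hsub ⟨RingHom.ker (eval x), RingHom.ker_isPrime _⟩ hx
  obtain ⟨t, ht⟩ := exists_forall_mem_eval_eq_zero 𝔮.isPrime.ne_top
  refine ⟨t, funext fun s => ?_⟩
  have hmem : X s - C (x s) ∈ (PrimeSpectrum.comap φ 𝔮).asIdeal := by
    rw [h𝔮]
    simp
  simpa [φ, sub_eq_zero] using ht _ hmem

theorem holdsGenerically_of_algebraicIndependent {σ τ : Type*} [Finite σ] [Finite τ]
    {P : (σ → ℂ) → Prop} {F : σ → MvPolynomial τ ℂ} (hF : AlgebraicIndependent ℂ F)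
    (hP : ∀ t : τ → ℂ, P fun s => eval t (F s)) : HoldsGenerically P := by
  obtain ⟨q, hq, hsub⟩ := exists_ne_zero_setOf_eval_ne_zero_subset_range hF
  refine ⟨{x | eval x q ≠ 0}, ?_, ⟨{q}, by ext; simp⟩, fun x hx => ?_⟩
  · by_contra! hempty
    exact hq (MvPolynomial.funext fun x => by
      simpa using Set.eq_empty_iff_forall_notMem.mp hempty x)
  · obtain ⟨t, rfl⟩ := hsub hx
    exact hP t

variable {𝕜 σ τ : Type*} [NontriviallyNormedField 𝕜]

theorem algebraicIndependent_of_range_mem_nhds [Finite σ] {F : σ → MvPolynomial τ 𝕜}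
    {x : σ → 𝕜} (hF : (Set.range fun (t : τ → 𝕜) s => eval t (F s)) ∈ nhds x) :
    AlgebraicIndependent 𝕜 F := by
  cases nonempty_fintype σ
  obtain ⟨ε, hε, hball⟩ := Metric.mem_nhds_iff.mp hF
  rw [algebraicIndependent_iff]
  refine fun q hq => funext_set (fun s => Metric.ball (x s) ε)
    (fun s => infinite_of_mem_nhds (x s) (Metric.ball_mem_nhds _ hε)) fun z hz => ?_
  rw [← ball_pi _ hε] at hz
  obtain ⟨t, rfl⟩ := hball hz
  have ht : aeval t (bind₁ F q) = 0 := by rw [bind₁, hq, map_zero]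
  simpa [aeval_bind₁, aeval_eq_eval] using ht

theorem algebraicIndependent_of_forall_exists_hasLineDerivAt [CompleteSpace 𝕜]
    [Fintype σ] [Finite τ] {F : σ → MvPolynomial τ 𝕜} (p : τ → 𝕜)
    (hF : ∀ w : σ → 𝕜, ∃ v, HasLineDerivAt 𝕜 (fun t s => eval t (F s)) w p v) :
    AlgebraicIndependent 𝕜 F := by
  cases nonempty_fintype τ
  let f : (τ → 𝕜) → σ → 𝕜 := fun t s => eval t (F s)
  have hf : HasStrictFDerivAt f (fderiv 𝕜 f p) p :=
    (analyticAt_pi_iff.mpr fun s =>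
      AnalyticOnNhd.eval_mvPolynomial (F s) p (Set.mem_univ p)).hasStrictFDerivAt
  have hsurj : (fderiv 𝕜 f p).range = ⊤ := LinearMap.range_eq_top.mpr fun w => by
    obtain ⟨v, hv⟩ := hF w
    exact ⟨v, hf.differentiableAt.lineDeriv_eq_fderiv.symm.trans hv.lineDeriv⟩
  refine algebraicIndependent_of_range_mem_nhds (x := f p) ?_
  rw [← hf.map_nhds_eq_of_surj hsurj]
  exact Filter.range_mem_map

end DominantPolynomialMaps

section LinearSystems

open Finset

variable {ι A B : Type*} [Fintype ι] [DecidableEq A] [DecidableEq B] {f : ι → A} {g : ι → B}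
  {m n : ℕ}

/- Hall's condition: a set `s` of edges meets at least `#s / (m + n)` vertices on either side, hence
has at least `m * #s / (m + n) + n * #s / (m + n)` slots available. -/
theorem card_le_mul_card_image_add_mul_card_image (hf : ∀ a, #{e | f e = a} ≤ m + n)
    (hg : ∀ b, #{e | g e = b} ≤ m + n) (s : Finset ι) :
    #s ≤ m * #(s.image f) + n * #(s.image g) := by
  have hsf : #s ≤ (m + n) * #(s.image f) := card_le_mul_card_image s _ fun a _ =>
    (card_le_card (filter_subset_filter _ (subset_univ s))).trans (hf a)
  have hsg : #s ≤ (m + n) * #(s.image g) := card_le_mul_card_image s _ fun b _ =>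
    (card_le_card (filter_subset_filter _ (subset_univ s))).trans (hg b)
  rcases (m + n).eq_zero_or_pos with hmn | hmn
  · exact hsf.trans (by simp [hmn])
  · refine Nat.le_of_mul_le_mul_left ?_ hmn
    calc (m + n) * #s = m * #s + n * #s := add_mul ..
      _ ≤ m * ((m + n) * #(s.image f)) + n * ((m + n) * #(s.image g)) := by gcongr
      _ = (m + n) * (m * #(s.image f) + n * #(s.image g)) := by ring

theorem exists_finset_forall_card_fiber_le [DecidableEq ι] (hf : ∀ a, #{e | f e = a} ≤ m + n)
    (hg : ∀ b, #{e | g e = b} ≤ m + n) :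
    ∃ s : Finset ι, (∀ a, #{e ∈ s | f e = a} ≤ m) ∧ ∀ b, #{e ∈ sᶜ | g e = b} ≤ n := by
  let slots (e : ι) : Finset (A × Fin m ⊕ B × Fin n) :=
    ({f e} ×ˢ univ).disjSum ({g e} ×ˢ univ)
  have hslots (s : Finset ι) :
      s.biUnion slots = (s.image f ×ˢ univ).disjSum (s.image g ×ˢ univ) := by
    ext (⟨a, t⟩ | ⟨b, l⟩) <;> simp [slots, eq_comm]
  obtain ⟨c, hc, hmem⟩ := (all_card_le_biUnion_card_iff_exists_injective slots).mp fun s => by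
    rw [hslots, card_disjSum, card_product, card_product, card_fin, card_fin, mul_comm,
      mul_comm _ n]
    exact card_le_mul_card_image_add_mul_card_image hf hg s
  refine ⟨({e | (c e).isLeft} : Finset ι), fun a => ?_, fun b => ?_⟩
  · have hle := card_le_card_of_injOn (s := {e ∈ ({e | (c e).isLeft} : Finset ι) | f e = a})
      (t := univ.image fun t => .inl (a, t)) c (fun e he => ?_) hc.injOn
    · exact hle.trans (card_image_le.trans_eq (card_fin m))
    · have := hmem e
      cases h : c e <;> simp_all [slots]
  · have hle := card_le_card_of_injOn (s := {e ∈ ({e | (c e).isLeft} : Finset ι)ᶜ | g e = b})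
      (t := univ.image fun l => .inr (b, l)) c (fun e he => ?_) hc.injOn
    · exact hle.trans (card_image_le.trans_eq (card_fin n))
    · have := hmem e
      cases h : c e <;> simp_all [slots]

theorem exists_forall_mem_pow_dotProduct_eq {k ι : Type*} [Field k] {s : Finset ι} {n : ℕ}
    (hs : #s ≤ n) {x : ι → k} (hx : Set.InjOn x s) (w : ι → k) :
    ∃ y : Fin n → k, ∀ e ∈ s, (fun l : Fin n => x e ^ (l : ℕ)) ⬝ᵥ y = w e := by
  classical
  have hdeg : Lagrange.interpolate s x w ∈ Polynomial.degreeLT k n :=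
    Polynomial.mem_degreeLT.mpr
      ((Lagrange.degree_interpolate_lt w hx).trans_le (by exact_mod_cast hs))
  refine ⟨Polynomial.degreeLTEquiv k n ⟨_, hdeg⟩, fun e he => ?_⟩
  rw [← Lagrange.eval_interpolate_at_node w hx he, Polynomial.eval_eq_sum_degreeLTEquiv hdeg]
  exact sum_congr rfl fun l _ => mul_comm _ _

theorem exists_forall_exists_dotProduct_add_dotProduct_eq (k : Type*) [Field k] [Infinite k]
    [Countable A] (hf : ∀ a, #{e | f e = a} ≤ m + n) (hg : ∀ b, #{e | g e = b} ≤ m + n)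
    (hfg : Function.Injective fun e => (f e, g e)) :
    ∃ (α : A → Fin n → k) (β : ι → Fin m → k), ∀ w : ι → k,
      ∃ (x : A → Fin m → k) (y : B → Fin n → k), ∀ e,
        α (f e) ⬝ᵥ y (g e) + x (f e) ⬝ᵥ β e = w e := by
  classical
  obtain ⟨s, hsf, hsg⟩ := exists_finset_forall_card_fiber_le hf hg
  obtain ⟨ν, hν⟩ := exists_injective_nat A
  obtain ⟨μ, hμ⟩ := exists_injective_nat ι
  let N := Infinite.natEmbedding k
  refine ⟨fun a l => N (ν a) ^ (l : ℕ),
    fun e => if e ∈ s then fun t => N (μ e) ^ (t : ℕ) else 0, fun w => ?_⟩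
  choose y hy using fun b => exists_forall_mem_pow_dotProduct_eq (hsg b) (x := fun e => N (ν (f e)))
    (fun e he e' he' h => hfg <| Prod.ext (hν (N.injective h)) <|
      (mem_filter.mp he).2.trans (mem_filter.mp he').2.symm) w
  choose x hx using fun a => exists_forall_mem_pow_dotProduct_eq (hsf a) (x := fun e => N (μ e))
    (N.injective.comp hμ).injOn
    fun e => w e - (fun l : Fin n => N (ν (f e)) ^ (l : ℕ)) ⬝ᵥ y (g e)
  refine ⟨x, y, fun e => ?_⟩
  beta_reduce
  by_cases he : e ∈ s
  · rw [if_pos he, dotProduct_comm (x _), hx (f e) e (by simp [he]), add_sub_cancel]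
  · rw [if_neg he, dotProduct_zero, add_zero, hy (g e) e (by simp [he])]

theorem card_filter_snd_eq_le {A B J : Type*} [Fintype A] [Fintype J] [DecidableEq A]
    [DecidableEq B] (I : Finset (A × B)) (b : B) :
    #{e : I × J | e.1.1.2 = b} ≤ Fintype.card J * #{a | (a, b) ∈ I} := by
  rw [mul_comm, ← card_univ, ← card_product]
  refine card_le_card_of_injOn (fun e => (e.1.1.1, e.2)) ?_ ?_
  · rintro ⟨⟨⟨a, b'⟩, hab⟩, j⟩ he
    obtain rfl : b' = b := by simpa using he
    simpa using hab
  · rintro ⟨⟨⟨a, b⟩, hab⟩, j⟩ he ⟨⟨⟨a', b'⟩, hab'⟩, j'⟩ he' h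
    simp_all

theorem card_filter_fst_eq_le {A B J : Type*} [Fintype B] [Fintype J] [DecidableEq A]
    [DecidableEq B] [DecidableEq J] (I : Finset (A × B)) (r : A × J) :
    #{e : I × J | (e.1.1.1, e.2) = r} ≤ #{b | (r.1, b) ∈ I} := by
  obtain ⟨a, j⟩ := r
  refine card_le_card_of_injOn (fun e => e.1.1.2) ?_ ?_
  · rintro ⟨⟨⟨a', b⟩, hab⟩, j'⟩ he
    obtain ⟨rfl, rfl⟩ : a' = a ∧ j' = j := by simpa using he
    simpa using hab
  · rintro ⟨⟨⟨a, b⟩, hab⟩, j⟩ he ⟨⟨⟨a', b'⟩, hab'⟩, j'⟩ he' h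
    simp_all

end LinearSystems

section AlignedChannels

open MvPolynomial

variable {G K m n : ℕ} (I : Finset (Fin G × (Fin G × Fin K)))

/-- The channel coefficients that agree with `h` except that, for `(i, a) ∈ I`, the first `K`
entries of the first row of the channel from BS `i` to the user `a` are solved from the alignment
equations with receive beamformers `(1, x a)` (up to conjugation) and transmit beamformers
`(e_j, y (i, j))`. -/
def alignedChannel {R : Type*} [CommRing R] (h : ChannelIndex G K (m + 1) (K + n) → R)
    (x : Fin G × Fin K → Fin m → R) (y : Fin G × Fin K → Fin n → R) :
    ChannelIndex G K (m + 1) (K + n) → R := fun (i, a, r, c) =>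
  if (i, a) ∈ I ∧ r = 0 then
    Fin.addCases (motive := fun _ => R)
      (fun j => -((∑ l, h (i, a, 0, Fin.natAdd K l) * y (i, j) l) +
        ∑ t, x a t * (h (i, a, t.succ, Fin.castAdd n j) +
          ∑ l, h (i, a, t.succ, Fin.natAdd K l) * y (i, j) l)))
      (fun l => h (i, a, 0, Fin.natAdd K l)) c
  else h (i, a, r, c)

theorem map_alignedChannel {R S : Type*} [CommRing R] [CommRing S] (φ : R →+* S)
    (h : ChannelIndex G K (m + 1) (K + n) → R) (x : Fin G × Fin K → Fin m → R)
    (y : Fin G × Fin K → Fin n → R) (s : ChannelIndex G K (m + 1) (K + n)) :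
    φ (alignedChannel I h x y s) =
      alignedChannel I (fun s => φ (h s)) (fun a t => φ (x a t)) (fun b l => φ (y b l)) s := by
  obtain ⟨i, a, r, c⟩ := s
  simp only [alignedChannel]
  split_ifs
  · refine Fin.addCases (fun j => ?_) (fun l => ?_) c <;> simp
  · rfl

theorem partialIAFeasible_alignedChannel (h : ChannelIndex G K (m + 1) (K + n) → ℂ)
    (x : Fin G × Fin K → Fin m → ℂ) (y : Fin G × Fin K → Fin n → ℂ) :
    PartialIAFeasible (alignedChannel I h x y) I := by
  refine ⟨fun a => Fin.cons 1 (star (x a)), fun b => Fin.append (Pi.single b.2 1) (y b),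
    fun a hu => by simpa using congrFun hu 0, fun g => ?_, fun i a hia j => ?_⟩
  · refine Fintype.linearIndependent_iff.mpr fun c hc k => ?_
    simpa [Pi.single_apply] using congrFun hc (Fin.castAdd n k)
  · simp only [dotProduct, mulVec, channelMatrix, Fin.sum_univ_succ, Fin.sum_univ_add, of_apply,
      Pi.star_apply, Fin.cons_zero, Fin.cons_succ, Fin.append_left, Fin.append_right,
      Pi.single_apply, star_one, star_star, one_mul, mul_ite, mul_one, mul_zero,
      Finset.sum_ite_eq', Finset.mem_univ, if_true, alignedChannel, hia, true_and,
      Fin.addCases_left, Fin.addCases_right, Fin.succ_ne_zero, if_false]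
    ring

variable {I} {𝕜 : Type*} [NontriviallyNormedField 𝕜]

theorem hasDerivAt_alignedChannel_of_mem {i : Fin G} {a : Fin G × Fin K} (hia : (i, a) ∈ I)
    (h w : ChannelIndex G K (m + 1) (K + n) → 𝕜) (x : Fin G × Fin K → Fin m → 𝕜)
    (y : Fin G × Fin K → Fin n → 𝕜) (j : Fin K) :
    HasDerivAt
      (fun z : 𝕜 => alignedChannel I (h + z • w) (z • x) (z • y) (i, a, 0, Fin.castAdd n j))
      (-((fun l => h (i, a, 0, Fin.natAdd K l)) ⬝ᵥ y (i, j) +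
        x a ⬝ᵥ fun t => h (i, a, t.succ, Fin.castAdd n j))) 0 := by
  -- Every term of the solved entry has a factor from `z • x` or `z • y`.
  let q (z : 𝕜) : 𝕜 := -((∑ l, (h + z • w) (i, a, 0, Fin.natAdd K l) * y (i, j) l) +
    ∑ t, x a t * ((h + z • w) (i, a, t.succ, Fin.castAdd n j) +
      ∑ l, (h + z • w) (i, a, t.succ, Fin.natAdd K l) * (z • y) (i, j) l))
  have hq : DifferentiableAt 𝕜 q 0 := by
    simp only [q, Pi.add_apply, Pi.smul_apply, smul_eq_mul]
    fun_prop
  have hfactor (z : 𝕜) :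
      alignedChannel I (h + z • w) (z • x) (z • y) (i, a, 0, Fin.castAdd n j) = z * q z := by
    simp only [alignedChannel, hia, and_self, if_true, Fin.addCases_left, q, mul_neg, mul_add,
      Finset.mul_sum, Pi.smul_apply, smul_eq_mul, mul_assoc, mul_left_comm z]
  simp only [hfactor]
  exact ((hasDerivAt_id' (0 : 𝕜)).fun_mul hq.hasDerivAt).congr_deriv (by simp [q, dotProduct])

/-- The indices of the free parameters of `alignedChannel`: channel coefficients, receive
beamformers and transmit beamformers. -/
abbrev AlignmentParameter (G K m n : ℕ) : Type :=
  ChannelIndex G K (m + 1) (K + n) ⊕ (Fin G × Fin K) × Fin m ⊕ (Fin G × Fin K) × Fin n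

/-- The polynomial map whose values are the coefficients `alignedChannel I h x y`. -/
noncomputable def alignedChannelPoly (R : Type*) [CommRing R]
    (I : Finset (Fin G × (Fin G × Fin K))) (s : ChannelIndex G K (m + 1) (K + n)) :
    MvPolynomial (AlignmentParameter G K m n) R :=
  alignedChannel I (fun s => X (.inl s)) (fun a t => X (.inr (.inl (a, t))))
    (fun b l => X (.inr (.inr (b, l)))) s

theorem eval_alignedChannelPoly {R : Type*} [CommRing R] (p : AlignmentParameter G K m n → R)
    (s : ChannelIndex G K (m + 1) (K + n)) :
    eval p (alignedChannelPoly R I s) = alignedChannel I (fun s => p (.inl s))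
      (fun a t => p (.inr (.inl (a, t)))) (fun b l => p (.inr (.inr (b, l)))) s := by
  simp only [alignedChannelPoly, map_alignedChannel, eval_X]

theorem exists_hasLineDerivAt_alignedChannelPoly
    {h : ChannelIndex G K (m + 1) (K + n) → 𝕜} (w : ChannelIndex G K (m + 1) (K + n) → 𝕜)
    {x : Fin G × Fin K → Fin m → 𝕜} {y : Fin G × Fin K → Fin n → 𝕜}
    (hxy : ∀ i a, (i, a) ∈ I → ∀ j,
      (fun l => h (i, a, 0, Fin.natAdd K l)) ⬝ᵥ y (i, j) +
        x a ⬝ᵥ (fun t => h (i, a, t.succ, Fin.castAdd n j)) = -w (i, a, 0, Fin.castAdd n j)) :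
    ∃ v, HasLineDerivAt 𝕜 (fun p s => eval p (alignedChannelPoly 𝕜 I s)) w (Sum.elim h 0) v := by
  refine ⟨Sum.elim w (Sum.elim (fun b => x b.1 b.2) fun b => y b.1 b.2), hasDerivAt_pi.mpr ?_⟩
  rintro ⟨i, a, r, c⟩
  have hline (s : ChannelIndex G K (m + 1) (K + n)) :
      HasDerivAt (fun z : 𝕜 => h s + z * w s) (w s) 0 := by
    simpa using ((hasDerivAt_id (0 : 𝕜)).mul_const (w s)).const_add (h s)
  have hval (z : 𝕜) : eval (Sum.elim h 0 +
      z • Sum.elim w (Sum.elim (fun b => x b.1 b.2) fun b => y b.1 b.2))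
        (alignedChannelPoly 𝕜 I (i, a, r, c)) =
      alignedChannel I (h + z • w) (z • x) (z • y) (i, a, r, c) := by
    rw [eval_alignedChannelPoly]
    congr 1 <;> ext <;> simp
  simp only [hval]
  by_cases hr : (i, a) ∈ I ∧ r = 0
  · obtain ⟨hia, rfl⟩ := hr
    refine Fin.addCases (fun j => ?_) (fun l => ?_) c
    · simpa [hxy i a hia j] using hasDerivAt_alignedChannel_of_mem hia h w x y j
    · simpa [alignedChannel] using hline (i, a, 0, Fin.natAdd K l)
  · simpa [alignedChannel, hr] using hline (i, a, r, c)

theorem algebraicIndependent_alignedChannelPoly (𝕜 : Type*) [NontriviallyNormedField 𝕜]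
    [CompleteSpace 𝕜]
    (huser : ∀ a : Fin G × Fin K,
      K * (Finset.univ.filter fun i : Fin G => (i, a) ∈ I).card ≤ m + n)
    (hBS : ∀ i : Fin G,
      (Finset.univ.filter fun a : Fin G × Fin K => (i, a) ∈ I).card ≤ m + n) :
    AlgebraicIndependent 𝕜 (alignedChannelPoly (m := m) (n := n) 𝕜 I) := by
  obtain ⟨α, β, hαβ⟩ := exists_forall_exists_dotProduct_add_dotProduct_eq 𝕜
    (fun a => (card_filter_snd_eq_le (J := Fin K) I a).trans (by simpa using huser a))
    (fun b => (card_filter_fst_eq_le I b).trans (hBS b.1))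
    (by rintro ⟨⟨⟨i, a⟩, hia⟩, j⟩ ⟨⟨⟨i', a'⟩, hia'⟩, j'⟩ h; simp_all)
  let h : ChannelIndex G K (m + 1) (K + n) → 𝕜 := fun (i, a, r, c) =>
    Fin.cases (motive := fun _ => 𝕜) (Fin.addCases (motive := fun _ => 𝕜) (fun _ => 0) (α a) c)
      (fun t => Fin.addCases (motive := fun _ => 𝕜)
        (fun j => if hia : (i, a) ∈ I then β (⟨(i, a), hia⟩, j) t else 0) (fun _ => 0) c) r
  refine algebraicIndependent_of_forall_exists_hasLineDerivAt (Sum.elim h 0) fun w => ?_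
  obtain ⟨x, y, hxy⟩ := hαβ fun e => -w (e.1.1.1, e.1.1.2, 0, Fin.castAdd n e.2)
  refine exists_hasLineDerivAt_alignedChannelPoly w (x := x) (y := y) fun i a hia j => ?_
  simpa [h, hia] using hxy (⟨(i, a), hia⟩, j)

end AlignedChannels

theorem card_filter_mk_left_mem_allPairs_add_one {G K : ℕ} (a : Fin G × Fin K) :
    (Finset.univ.filter fun i : Fin G => (i, a) ∈ allPairs G K).card + 1 = G := by
  have herase : (Finset.univ.filter fun i : Fin G => (i, a) ∈ allPairs G K) =
      Finset.univ.erase a.1 := by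
    ext i
    simp [allPairs, eq_comm]
  rw [herase, Finset.card_erase_add_one (Finset.mem_univ _), Finset.card_fin]

theorem card_filter_mk_right_mem_allPairs_add {G K : ℕ} (i : Fin G) :
    (Finset.univ.filter fun a : Fin G × Fin K => (i, a) ∈ allPairs G K).card + K = G * K := by
  have herase : (Finset.univ.filter fun a : Fin G × Fin K => (i, a) ∈ allPairs G K) =
      Finset.univ.erase i ×ˢ Finset.univ := by
    ext a
    simp [allPairs]
  rw [herase, Finset.card_product, Finset.card_fin, ← add_one_mul,
    Finset.card_erase_add_one (Finset.mem_univ _), Finset.card_fin]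

theorem corollary1_general {G K M N : ℕ} (hM : 1 ≤ M) (hN : K ≤ N)
    (I : Finset (Fin G × (Fin G × Fin K)))
    (huser : ∀ a : Fin G × Fin K,
      K * ((Finset.univ.filter fun i : Fin G => (i, a) ∈ I).card + 1) + 1 ≤ M + N)
    (hBS : ∀ i : Fin G,
      (Finset.univ.filter fun a : Fin G × Fin K => (i, a) ∈ I).card + K + 1 ≤ M + N) :
    HoldsGenerically fun h : ChannelIndex G K M N → ℂ => PartialIAFeasible h I := by
  obtain ⟨m, rfl⟩ := Nat.exists_eq_add_of_le' hM
  obtain ⟨n, rfl⟩ := Nat.exists_eq_add_of_le hN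
  refine holdsGenerically_of_algebraicIndependent
    (algebraicIndependent_alignedChannelPoly (m := m) (n := n) ℂ
      (fun a => by linarith [huser a]) fun i => by linarith [hBS i]) fun p => ?_
  simp only [eval_alignedChannelPoly]
  exact partialIAFeasible_alignedChannel I _ _ _

theorem corollary1 (G K M N : ℕ) (hM : 1 ≤ M) (hN : K ≤ N) :
    (∀ q : ℕ, 1 ≤ q → q + 1 ≤ G → K * (q + 1) + 1 ≤ M + N →
      ∀ I : Finset (Fin G × (Fin G × Fin K)), I ⊆ allPairs G K →
        (∀ a : Fin G × Fin K, (Finset.univ.filter fun i : Fin G => (i, a) ∈ I).card ≤ q) →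
        (∀ i : Fin G,
          (Finset.univ.filter fun a : Fin G × Fin K => (i, a) ∈ I).card ≤ K * q) →
        HoldsGenerically fun h : ChannelIndex G K M N → ℂ => PartialIAFeasible h I) ∧
    (2 ≤ G → G * K + 1 ≤ M + N →
      HoldsGenerically fun h : ChannelIndex G K M N → ℂ =>
        PartialIAFeasible h (allPairs G K)) :=
  ⟨fun q _ _ hMN I _ huser hBS => corollary1_general hM hN I
      (fun a => hMN.trans' (by gcongr; exact huser a)) fun i => by linarith [hBS i],
    fun _ hMN => corollary1_general hM hN _
      (fun a => by rwa [card_filter_mk_left_mem_allPairs_add_one, mul_comm])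
      fun i => by rwa [card_filter_mk_right_mem_allPairs_add]⟩
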